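/- Theorem 4.1. Let $N>0$ and $\lambda\ge \frac{2N^2}{(1+N)(1+3N)}$. On $\Omega=\{0,1,2,\dots\}$ consider the tridiagonal matrix $P_\lambda$ with entries $P_\lambda(n,n+1)=p_n^\lambda$, $P_\lambda(n,n)=r_n^\lambda$, $P_\lambda(n,n-1)=q_n^\lambda$ (and $0$ elsewhere), where $$p_n^\lambda=\frac{1}{2(1+\lambda)}\cdot\frac{1+(2n-1)N}{1+(2n+1)N},\qquad q_n^\lambda=\frac{1}{2(1+\lambda)}\cdot\frac{1+(2n+1)N}{1+(2n-1)N},\qquad r_n^\lambda=1-p_n^\lambda-q_n^\lambda\qquad(n\ge 1),$$ and $p_0^\lambda=\frac{1}{(1+\lambda)(N+1)}=1-r_0^\lambda$. Then $P_\lambda$ is the transition matrix of a Markov chain (its entries are nonnegative and its rows sum to one), and this chain has a unique stationary probability distribution $\nu$. For every starting site $j\in\Omega$ there are constants $c,C>0$, depending only on $j$, $N$ and $\lambda$, such that the law $\mu_t$ at time $t$ of the chain started at $j$ satisfies $$\frac{c}{\sqrt t}\le \|\nu-\mu_t\|_{TV}\le C\,\frac{\log t}{\sqrt t}$$ for all sufficiently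 large integers $t$, where $\|\nu-\mu\|_{TV}=\frac12\sum_{n\in\Omega}|\nu(n)-\mu(n)|$. Moreover, $P_\lambda$ has no spectral gap: for every $\delta>0$ the interval $(1-\delta,1)$ contains a point of the spectrum of the operator $(P_\lambda f)(m)=\sum_n P_\lambda(m,n)f(n)$ on $\ell^2(\nu)$. -/

import Mathlib

open Filter

namespace ChebyshevWalk

/-- The probability `p_n` of the step `n → n + 1`. -/
noncomputable def up (N lam : ℝ) (n : ℕ) : ℝ :=
  if n = 0 then 1 / ((1 + lam) * (N + 1))
  else 1 / (2 * (1 + lam)) * ((1 + (2 * (n : ℝ) - 1) * N) / (1 + (2 * (n : ℝ) + 1) * N))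

/-- The probability `q_n` of the step `n → n - 1`; there is no such step from `0`. -/
noncomputable def down (N lam : ℝ) (n : ℕ) : ℝ :=
  if n = 0 then 0
  else 1 / (2 * (1 + lam)) * ((1 + (2 * (n : ℝ) + 1) * N) / (1 + (2 * (n : ℝ) - 1) * N))

/-- The probability `r_n = 1 - p_n - q_n` of staying at `n`. -/
noncomputable def stay (N lam : ℝ) (n : ℕ) : ℝ :=
  1 - up N lam n - down N lam n

/-- The tridiagonal matrix of one-step probabilities; the row index is the current site. -/
noncomputable def walk (N lam : ℝ) (m n : ℕ) : ℝ :=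
  if n = m + 1 then up N lam m
  else if n = m then stay N lam m
  else if n + 1 = m then down N lam m
  else 0

/-- A matrix on `ℕ × ℕ` with nonnegative entries and row sums one. -/
def IsStochastic (P : ℕ → ℕ → ℝ) : Prop :=
  (∀ m n, 0 ≤ P m n) ∧ ∀ m, HasSum (fun n => P m n) 1

/-- The law at time `t` of the chain with one-step matrix `P` started at the site `j`,
that is, the row `j` of the matrix power `P ^ t`. -/
noncomputable def law (P : ℕ → ℕ → ℝ) (j : ℕ) : ℕ → ℕ → ℝ
  | 0 => fun n => if n = j then 1 else 0
  | t + 1 => fun n => ∑' m, law P j t m * P m n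

/-- `ν` is a stationary probability distribution of `P`: `ν P = ν`. -/
structure IsStationary (P : ℕ → ℕ → ℝ) (ν : ℕ → ℝ) : Prop where
  nonneg : ∀ n, 0 ≤ ν n
  hasSum_one : HasSum ν 1
  invariant : ∀ n, HasSum (fun m => ν m * P m n) (ν n)

/-- The total variation distance of two probability distributions on `ℕ`. -/
noncomputable def tvDist (ν μ : ℕ → ℝ) : ℝ :=
  (1 / 2) * ∑' n, |ν n - μ n|

/-- The weighted space `ℓ²(w)` of real sequences. -/
def ell2 (w : ℕ → ℝ) : Set (ℕ → ℝ) :=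
  {f | Summable fun n => w n * f n ^ 2}

/-- The action `(P f)(m) = ∑ n, P(m, n) f(n)` on functions. -/
noncomputable def act (P : ℕ → ℕ → ℝ) (f : ℕ → ℝ) (m : ℕ) : ℝ :=
  ∑' n, P m n * f n

/-- The real spectrum of `P` as an operator on `ℓ²(w)`: the numbers `s` for which `P - s` is not
a bijection of `ℓ²(w)`. For a bounded operator on a Hilbert space the inverse of a bijective
`P - s` is bounded, so this is the usual spectrum. -/
def specSet (P : ℕ → ℕ → ℝ) (w : ℕ → ℝ) : Set ℝ :=
  {s | ¬ ∀ g ∈ ell2 w, ∃! f : ℕ → ℝ, f ∈ ell2 w ∧ ∀ m, act P f m - s * f m = g m}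

/-- The spectrum on `ℓ²(w)` leaves a gap just below the eigenvalue `1`. -/
def HasSpectralGap (P : ℕ → ℕ → ℝ) (w : ℕ → ℝ) : Prop :=
  ∃ δ : ℝ, 0 < δ ∧ ∀ s ∈ specSet P w, ¬ (1 - δ < s ∧ s < 1)

end ChebyshevWalk

/-!
The chain is `P = (lam + P₀) / (1 + lam)`, where `P₀` is the Jacobi operator of the orthogonal
polynomials `Q_n` for the arcsine law on `[-1, 1]` plus a point mass `N` at `1`, normalised by
`Q_n(1) = 1`. These polynomials are explicit: with `x = cos θ`, `Q_n` is
`(1 + (2n - 1)N) cos nθ - N D_{n-1}(θ)` with `D` the Dirichlet kernel (`eigenfun`), and `P` acts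
on them as multiplication by the symbol `φ(θ) = (cos θ + lam) / (1 + lam)` (`act_eigenfun`).

*Law.* The chain is reversible with respect to `ν = statDist N`, which telescopes and therefore
has an explicit tail. The density of the law with respect to `ν` evolves by `P`, so that it is
`1 + (1 / (N π)) ∫₀^π φ^t Q_j Q_n dθ` (`law_eq`); the summand `1` comes from the point mass.
At `t = 0` this is the orthogonality of the `Q_n` (`density_zero`).

*Upper bound.* Since `|φ| ≤ exp (-a θ²)` on `[0, π]` (`abs_symbol_le`; here `lam > 0` keeps `φ`
away from `-1`), the integral is `O(n / √t)`, while `ν n = O(n⁻²)`. Summing `1 / n` over the sites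
that are reachable by time `t` gives `log t / √t`, and the mass of `ν` beyond them is `O(1 / t)`
(`exists_tvDist_le`).

*Lower bound.* The term at the site `0` alone is of order `∫₀^π φ^t Q_j dθ`. As `Q_j` is
`1 + O(θ)` at `θ = 0`, this integral is at least a constant times `1 / √t`
(`exists_le_moment_zero`).

*Spectrum.* Every value `s = φ(θ)` lies in the spectrum, because `(P - s) f = δ₀` has no solution
in `ℓ²(ν)`: the weighted Casoratian of `f` and `n ↦ Q_n(θ)` is a nonzero constant, but it tends
to `0` since `ν n * Q_n(θ)²` is bounded and `ν n * f n ^ 2` tends to `0`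
(`not_exists_resolvent`). Values of `φ` accumulate at `1`.
-/

open Filter

namespace ChebyshevWalk

/-! ### Transition probabilities -/

variable {N lam : ℝ}

@[simp] theorem up_zero : up N lam 0 = 1 / ((1 + lam) * (N + 1)) := by simp [up]

@[simp] theorem down_zero : down N lam 0 = 0 := by simp [down]

theorem up_succ (n : ℕ) : up N lam (n + 1) =
    1 / (2 * (1 + lam)) * ((1 + (2 * (n : ℝ) + 1) * N) / (1 + (2 * (n : ℝ) + 3) * N)) := by
  simp only [up, Nat.succ_ne_zero, if_false]
  push_cast
  ring_nf

theorem down_succ (n : ℕ) : down N lam (n + 1) =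
    1 / (2 * (1 + lam)) * ((1 + (2 * (n : ℝ) + 3) * N) / (1 + (2 * (n : ℝ) + 1) * N)) := by
  simp only [down, Nat.succ_ne_zero, if_false]
  push_cast
  ring_nf

theorem lam_pos (hN : 0 < N) (hlam : 2 * N ^ 2 / ((1 + N) * (1 + 3 * N)) ≤ lam) : 0 < lam :=
  lt_of_lt_of_le (by positivity) hlam

theorem up_pos (hN : 0 < N) (hl : 0 < lam) (n : ℕ) : 0 < up N lam n := by
  cases n with
  | zero => rw [up_zero]; positivity
  | succ n => rw [up_succ]; positivity

theorem down_succ_pos (hN : 0 < N) (hl : 0 < lam) (n : ℕ) : 0 < down N lam (n + 1) := by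
  rw [down_succ]; positivity

theorem down_nonneg (hN : 0 < N) (hl : 0 < lam) (n : ℕ) : 0 ≤ down N lam n := by
  cases n with
  | zero => simp
  | succ n => exact (down_succ_pos hN hl n).le

/-- The lower bound on `lam` says exactly that `stay N lam 1 ≥ 0`; the other sites are less
restrictive. -/
theorem stay_nonneg (hN : 0 < N) (hlam : 2 * N ^ 2 / ((1 + N) * (1 + 3 * N)) ≤ lam) (n : ℕ) :
    0 ≤ stay N lam n := by
  have hl := lam_pos hN hlam
  cases n with
  | zero =>
    rw [stay, up_zero, down_zero]
    have : 1 / ((1 + lam) * (N + 1)) ≤ 1 := by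
      rw [div_le_one (by positivity)]; nlinarith [mul_pos hl hN]
    linarith
  | succ n =>
    rw [stay, up_succ, down_succ]
    have hn : (0 : ℝ) ≤ n := n.cast_nonneg
    rw [div_le_iff₀ (by positivity)] at hlam
    obtain ⟨x, hx⟩ : ∃ x, x = 1 + (2 * (n : ℝ) + 1) * N := ⟨_, rfl⟩
    have hy : 1 + (2 * (n : ℝ) + 3) * N = x + 2 * N := by rw [hx]; ring
    have hxN : 1 + N ≤ x := by rw [hx]; nlinarith [mul_nonneg hn hN.le]
    rw [hy, ← hx]
    have hx0 : 0 < x := by linarith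
    have hxy : (1 + N) * (1 + 3 * N) ≤ x * (x + 2 * N) := by
      apply mul_le_mul hxN <;> linarith
    have h2 : 2 * N ^ 2 ≤ lam * (x * (x + 2 * N)) :=
      hlam.trans (mul_le_mul_of_nonneg_left hxy hl.le)
    have : 1 - 1 / (2 * (1 + lam)) * (x / (x + 2 * N)) - 1 / (2 * (1 + lam)) * ((x + 2 * N) / x)
        = (2 * (lam * (x * (x + 2 * N)) - 2 * N ^ 2)) / (2 * (1 + lam) * (x * (x + 2 * N))) := by
      field_simp
      ring
    rw [this]
    apply div_nonneg
    · linarith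
    · positivity

theorem up_le_one (hN : 0 < N) (hlam : 2 * N ^ 2 / ((1 + N) * (1 + 3 * N)) ≤ lam) (n : ℕ) :
    up N lam n ≤ 1 := by
  have h1 := stay_nonneg hN hlam n
  have h2 := down_nonneg hN (lam_pos hN hlam) n
  rw [stay] at h1
  linarith

theorem down_le_one (hN : 0 < N) (hlam : 2 * N ^ 2 / ((1 + N) * (1 + 3 * N)) ≤ lam) (n : ℕ) :
    down N lam n ≤ 1 := by
  have h1 := stay_nonneg hN hlam n
  have h2 := (up_pos hN (lam_pos hN hlam) n).le
  rw [stay] at h1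
  linarith

/-- A row of `walk` has at most three nonzero entries. At `m = 0` the truncated `m - 1` is
harmless because `down N lam 0 = 0`. -/
theorem hasSum_walk_row (N lam : ℝ) (f : ℕ → ℝ) (m : ℕ) :
    HasSum (fun n => walk N lam m n * f n)
      (up N lam m * f (m + 1) + stay N lam m * f m + down N lam m * f (m - 1)) := by
  cases m with
  | zero =>
    have h := hasSum_sum_of_ne_finset_zero (L := .unconditional ℕ)
      (f := fun n => walk N lam 0 n * f n) (s := {1, 0})
      (fun n hn => by
        simp only [Finset.mem_insert, Finset.mem_singleton, not_or] at hn
        simp [walk, hn.1, hn.2])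
    simpa [walk] using h
  | succ m =>
    have h := hasSum_sum_of_ne_finset_zero (L := .unconditional ℕ)
      (f := fun n => walk N lam (m + 1) n * f n)
      (s := {m + 1 + 1, m + 1, m})
      (fun n hn => by
        simp only [Finset.mem_insert, Finset.mem_singleton, not_or] at hn
        simp [walk, hn.1, hn.2.1, hn.2.2])
    simpa [walk, add_assoc] using h

theorem act_walk (N lam : ℝ) (f : ℕ → ℝ) (m : ℕ) :
    act (walk N lam) f m =
      up N lam m * f (m + 1) + stay N lam m * f m + down N lam m * f (m - 1) :=
  (hasSum_walk_row N lam f m).tsum_eq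

theorem walk_nonneg (hN : 0 < N) (hlam : 2 * N ^ 2 / ((1 + N) * (1 + 3 * N)) ≤ lam) (m n : ℕ) :
    0 ≤ walk N lam m n := by
  have hl := lam_pos hN hlam
  unfold walk
  split_ifs
  · exact (up_pos hN hl m).le
  · exact stay_nonneg hN hlam m
  · exact down_nonneg hN hl m
  · exact le_rfl

theorem isStochastic_walk (hN : 0 < N) (hlam : 2 * N ^ 2 / ((1 + N) * (1 + 3 * N)) ≤ lam) :
    IsStochastic (walk N lam) := by
  refine ⟨walk_nonneg hN hlam, fun m => ?_⟩
  have h := hasSum_walk_row N lam (fun _ => 1) m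
  simp only [mul_one] at h
  convert h using 1
  rw [stay]; ring

/-! ### The stationary distribution -/

/-- The stationary distribution: the mass `N / (1 + N)` at `0`, and `2N / (b (b + 2N))` with
`b = 1 + (2n - 1)N` at `n ≥ 1`. -/
noncomputable def statDist (N : ℝ) : ℕ → ℝ
  | 0 => N / (1 + N)
  | n + 1 => 2 * N / ((1 + (2 * (n : ℝ) + 1) * N) * (1 + (2 * (n : ℝ) + 3) * N))

theorem statDist_pos (hN : 0 < N) (n : ℕ) : 0 < statDist N n := by
  cases n <;> rw [statDist] <;> positivity

theorem detailed_balance (hN : 0 < N) (hl : 0 < lam) (n : ℕ) :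
    statDist N n * up N lam n = statDist N (n + 1) * down N lam (n + 1) := by
  cases n with
  | zero =>
    rw [statDist, statDist, up_zero, down_succ]
    push_cast
    field_simp
    ring
  | succ n =>
    rw [statDist, statDist, up_succ, down_succ]
    push_cast
    have e : 1 + (2 * ((n : ℝ) + 1) + 1) * N = 1 + (2 * (n : ℝ) + 3) * N := by ring
    rw [e]
    field_simp

theorem statDist_mul_walk (hN : 0 < N) (hl : 0 < lam) (m n : ℕ) :
    statDist N m * walk N lam m n = statDist N n * walk N lam n m := by
  unfold walk
  by_cases h1 : n = m + 1
  · subst h1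
    rw [if_pos rfl, if_neg (by omega), if_neg (by omega), if_pos rfl, detailed_balance hN hl]
  by_cases h2 : n = m
  · subst h2; simp
  by_cases h3 : n + 1 = m
  · subst h3
    rw [if_neg h1, if_neg h2, if_pos rfl, if_pos rfl, detailed_balance hN hl]
  · simp [h1, h2, h3, Ne.symm h1, Ne.symm h2, Ne.symm h3]

theorem sum_range_statDist (hN : 0 < N) (m : ℕ) :
    ∑ n ∈ Finset.range (m + 1), statDist N n = 1 - 1 / (1 + (2 * (m : ℝ) + 1) * N) := by
  induction m with
  | zero =>
    simp only [zero_add, Finset.sum_range_one, statDist]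
    push_cast
    field_simp
    ring
  | succ m ih =>
    rw [Finset.sum_range_succ, ih, statDist]
    push_cast
    have e : 1 + (2 * ((m : ℝ) + 1) + 1) * N = 1 + (2 * (m : ℝ) + 3) * N := by ring
    rw [e]
    field_simp
    ring

theorem hasSum_statDist (hN : 0 < N) : HasSum (statDist N) 1 := by
  rw [hasSum_iff_tendsto_nat_of_nonneg (fun n => (statDist_pos hN n).le)]
  rw [← tendsto_add_atTop_iff_nat 1]
  simp only [sum_range_statDist hN]
  have h : Tendsto (fun m : ℕ => 1 + (2 * (m : ℝ) + 1) * N) atTop atTop := by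
    apply tendsto_atTop_add_const_left
    apply Tendsto.atTop_mul_const hN
    apply tendsto_atTop_add_const_right
    exact tendsto_natCast_atTop_atTop.const_mul_atTop (by norm_num)
  simpa using (tendsto_const_nhds (x := (1 : ℝ))).sub
    ((tendsto_const_nhds (x := (1 : ℝ))).div_atTop h)

theorem hasSum_col (hN : 0 < N) (hl : 0 < lam) (h : ℕ → ℝ) (n : ℕ) :
    HasSum (fun m => statDist N m * h m * walk N lam m n)
      (statDist N n * act (walk N lam) h n) := by
  rw [act_walk]
  have e : (fun m => statDist N m * h m * walk N lam m n) =
      fun m => statDist N n * (walk N lam n m * h m) := by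
    funext m
    rw [mul_right_comm, statDist_mul_walk hN hl, mul_assoc]
  rw [e]
  exact (hasSum_walk_row N lam h n).mul_left (statDist N n)

theorem isStationary_statDist (hN : 0 < N) (hl : 0 < lam) :
    IsStationary (walk N lam) (statDist N) where
  nonneg n := (statDist_pos hN n).le
  hasSum_one := hasSum_statDist hN
  invariant n := by
    have h := hasSum_col hN hl (fun _ => 1) n
    rw [act_walk] at h
    simp only [mul_one] at h
    convert h using 1
    rw [stay]; ring

/-- In a stationary distribution the flow from `n` to `n + 1` balances the reverse flow, by
summing the invariance equations at the sites `0, …, n`. -/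
theorem IsStationary.balance (hN : 0 < N) (hl : 0 < lam) {ν : ℕ → ℝ}
    (hν : IsStationary (walk N lam) ν) (n : ℕ) :
    ν n * up N lam n = ν (n + 1) * down N lam (n + 1) := by
  -- Column sums are row sums of the reversed chain, applied to `ν / statDist N`.
  have key : ∀ n, ν n = statDist N n * act (walk N lam) (fun m => ν m / statDist N m) n := by
    intro n
    have h := hasSum_col hN hl (fun m => ν m / statDist N m) n
    simp only [mul_div_cancel₀ _ (statDist_pos hN _).ne'] at h
    exact (hν.invariant n).unique h
  have e : ∀ n, statDist N n * (ν n / statDist N n) = ν n := fun n =>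
    mul_div_cancel₀ _ (statDist_pos hN _).ne'
  induction n with
  | zero =>
    have k := key 0
    rw [act_walk, down_zero, stay, down_zero] at k
    have d := detailed_balance hN hl 0
    linear_combination k + (ν 1 / statDist N 1) * d + (1 - up N lam 0) * e 0
      + down N lam 1 * e 1
  | succ n ih =>
    have k := key (n + 1)
    rw [act_walk, stay, Nat.add_sub_cancel] at k
    have d := detailed_balance hN hl (n + 1)
    have d' := detailed_balance hN hl n
    linear_combination k + (ν (n + 1 + 1) / statDist N (n + 1 + 1)) * d
      - (ν n / statDist N n) * d' + (1 - up N lam (n + 1) - down N lam (n + 1)) * e (n + 1)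
      + down N lam (n + 1 + 1) * e (n + 1 + 1) + up N lam n * e n + ih

theorem IsStationary.eq_statDist (hN : 0 < N) (hl : 0 < lam) {ν : ℕ → ℝ}
    (hν : IsStationary (walk N lam) ν) : ν = statDist N := by
  have h : ∀ n, ν n = ν 0 / statDist N 0 * statDist N n := by
    intro n
    induction n with
    | zero => rw [div_mul_cancel₀ _ (statDist_pos hN 0).ne']
    | succ n ih =>
      have h1 := hν.balance hN hl n
      have h2 := detailed_balance hN hl n
      apply mul_right_cancel₀ (down_succ_pos hN hl n).ne'
      rw [← h1, mul_assoc, ← h2, ih]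
      ring
  have h1 : HasSum ν (ν 0 / statDist N 0 * 1) := by
    rw [funext h]
    simpa only [← h 0] using (hasSum_statDist hN).mul_left (ν 0 / statDist N 0)
  have h2 := hν.hasSum_one.unique h1
  funext n
  rw [h n, ← mul_one (ν 0 / statDist N 0), ← h2, one_mul]

/-! ### Generalised eigenfunctions -/

/-- The symbol of the chain: the spectral parameter as a function of the angle `θ`. -/
noncomputable def symbol (lam θ : ℝ) : ℝ := (Real.cos θ + lam) / (1 + lam)

/-- The sum `2 ∑_{k < n} cos kθ - 1`, that is, the Dirichlet kernel of degree `n - 1`;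
the value `-1` at `n = 0` is the convention that continues its recursion downwards. -/
noncomputable def dirichlet (n : ℕ) (θ : ℝ) : ℝ :=
  2 * ∑ k ∈ Finset.range n, Real.cos (k * θ) - 1

/-- The generalised eigenfunction `(1 + (2n - 1)N) cos nθ - N D_{n-1}(θ)` of the chain, where
`D` is the Dirichlet kernel. As a polynomial in `cos θ` it is the orthogonal polynomial of degree
`n` for the sum of the arcsine law and the point mass `N` at `1`, normalised to be `1` at `1`. -/
noncomputable def eigenfun (N : ℝ) (n : ℕ) (θ : ℝ) : ℝ :=
  (1 + (2 * (n : ℝ) - 1) * N) * Real.cos (n * θ) - N * dirichlet n θ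

@[simp] theorem eigenfun_zero (θ : ℝ) : eigenfun N 0 θ = 1 := by
  simp [eigenfun, dirichlet]

theorem dirichlet_succ (n : ℕ) (θ : ℝ) :
    dirichlet (n + 1) θ = dirichlet n θ + 2 * Real.cos (n * θ) := by
  simp only [dirichlet, Finset.sum_range_succ]
  ring

theorem cos_add_two_mul (n : ℕ) (θ : ℝ) :
    Real.cos (((n + 2 : ℕ) : ℝ) * θ) =
      2 * Real.cos θ * Real.cos (((n + 1 : ℕ) : ℝ) * θ) - Real.cos (n * θ) := by
  have e1 : ((n + 2 : ℕ) : ℝ) * θ = ((n + 1 : ℕ) : ℝ) * θ + θ := by push_cast; ring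
  have e2 : (n : ℝ) * θ = ((n + 1 : ℕ) : ℝ) * θ - θ := by push_cast; ring
  rw [e1, e2, Real.cos_add, Real.cos_sub]
  ring

theorem one_sub_cos_mul_dirichlet (n : ℕ) (θ : ℝ) :
    (1 - Real.cos θ) * dirichlet (n + 1) θ =
      Real.cos (n * θ) - Real.cos (((n + 1 : ℕ) : ℝ) * θ) := by
  induction n with
  | zero => simp [dirichlet]; ring
  | succ n ih =>
    rw [dirichlet_succ, mul_add, ih, cos_add_two_mul]
    ring

theorem act_eigenfun (hN : 0 < N) (hl : 0 < lam) (θ : ℝ) (n : ℕ) :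
    act (walk N lam) (fun k => eigenfun N k θ) n = symbol lam θ * eigenfun N n θ := by
  have hl' : (1 + lam) ≠ 0 := by positivity
  rw [act_walk, symbol]
  cases n with
  | zero =>
    simp only [stay, up_zero, down_zero, eigenfun, dirichlet]
    simp
    field_simp
    ring
  | succ n =>
    obtain ⟨x, hx⟩ : ∃ x, x = 1 + (2 * (n : ℝ) + 1) * N := ⟨_, rfl⟩
    have hx0 : x ≠ 0 := by rw [hx]; positivity
    have hxN : x + 2 * N ≠ 0 := by rw [hx]; positivity
    have e1 : 1 + (2 * (n : ℝ) + 3) * N = x + 2 * N := by rw [hx]; ring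
    have e2 : 1 + (2 * ((n + 1 : ℕ) : ℝ) - 1) * N = x := by rw [hx]; push_cast; ring
    have e3 : 1 + (2 * ((n + 1 + 1 : ℕ) : ℝ) - 1) * N = x + 2 * N := by rw [hx]; push_cast; ring
    have e4 : 1 + (2 * (n : ℝ) - 1) * N = x - 2 * N := by rw [hx]; ring
    have hD := one_sub_cos_mul_dirichlet n θ
    have hD0 : dirichlet n θ = dirichlet (n + 1) θ - 2 * Real.cos (n * θ) := by
      rw [dirichlet_succ]; ring
    simp only [stay, up_succ, down_succ, Nat.add_sub_cancel, eigenfun]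
    rw [e1, e2, e3, e4, ← hx, dirichlet_succ (n + 1), hD0, cos_add_two_mul]
    generalize Real.cos (((n + 1 : ℕ) : ℝ) * θ) = c at *
    generalize dirichlet (n + 1) θ = D at *
    generalize Real.cos θ = z at *
    have hd : Real.cos (n * θ) = (1 - z) * D + c := by linarith
    rw [hd]
    field_simp
    ring

theorem abs_dirichlet_le (n : ℕ) (θ : ℝ) : |dirichlet n θ| ≤ 2 * n + 1 := by
  have h : |∑ k ∈ Finset.range n, Real.cos (k * θ)| ≤ n := by
    calc _ ≤ ∑ k ∈ Finset.range n, |Real.cos (k * θ)| := Finset.abs_sum_le_sum_abs _ _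
      _ ≤ ∑ k ∈ Finset.range n, (1 : ℝ) := Finset.sum_le_sum fun k _ => Real.abs_cos_le_one _
      _ = n := by simp
  rw [abs_le] at h ⊢
  constructor <;> (unfold dirichlet; linarith [h.1, h.2])

theorem abs_eigenfun_le (hN : 0 < N) (n : ℕ) (θ : ℝ) :
    |eigenfun N n θ| ≤ 2 * (1 + (2 * (n : ℝ) + 1) * N) := by
  have h1 : |(1 + (2 * (n : ℝ) - 1) * N) * Real.cos (n * θ)| ≤ 1 + (2 * (n : ℝ) + 1) * N := by
    rw [abs_mul]
    have hb : |1 + (2 * (n : ℝ) - 1) * N| ≤ 1 + (2 * (n : ℝ) + 1) * N := by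
      have : (0 : ℝ) ≤ n * N := by positivity
      rw [abs_le]
      constructor <;> nlinarith
    calc _ ≤ |1 + (2 * (n : ℝ) - 1) * N| * 1 :=
          mul_le_mul_of_nonneg_left (Real.abs_cos_le_one _) (abs_nonneg _)
      _ ≤ _ := by rw [mul_one]; exact hb
  have h2 : |N * dirichlet n θ| ≤ N * (2 * n + 1) := by
    rw [abs_mul, abs_of_pos hN]
    exact mul_le_mul_of_nonneg_left (abs_dirichlet_le n θ) hN.le
  have h3 := abs_sub ((1 + (2 * (n : ℝ) - 1) * N) * Real.cos (n * θ)) (N * dirichlet n θ)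
  rw [eigenfun]
  linarith

/-- The eigenfunctions are Lipschitz at `θ = 0`, where they take the value `1`. -/
theorem exists_abs_eigenfun_sub_one_le (N : ℝ) (n : ℕ) :
    ∃ B : ℝ, 0 ≤ B ∧ ∀ θ : ℝ, 0 ≤ θ → |eigenfun N n θ - 1| ≤ B * θ := by
  have hc : ∀ (k : ℕ) (θ : ℝ), 0 ≤ θ → |Real.cos (k * θ) - 1| ≤ k * θ := by
    intro k θ hθ
    have := Real.abs_cos_sub_cos_le (k * θ) 0
    rwa [Real.cos_zero, sub_zero, abs_of_nonneg (by positivity : (0 : ℝ) ≤ k * θ)] at this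
  refine ⟨|1 + (2 * (n : ℝ) - 1) * N| * n + 2 * |N| * ∑ k ∈ Finset.range n, (k : ℝ),
    by positivity, fun θ hθ => ?_⟩
  have e : eigenfun N n θ - 1 = (1 + (2 * (n : ℝ) - 1) * N) * (Real.cos (n * θ) - 1)
      - 2 * N * ∑ k ∈ Finset.range n, (Real.cos (k * θ) - 1) := by
    rw [Finset.sum_sub_distrib]
    simp only [eigenfun, dirichlet, Finset.sum_const, Finset.card_range, nsmul_eq_mul, mul_one]
    ring
  have h1 : |∑ k ∈ Finset.range n, (Real.cos (k * θ) - 1)| ≤ ∑ k ∈ Finset.range n, (k : ℝ) * θ :=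
    (Finset.abs_sum_le_sum_abs _ _).trans (Finset.sum_le_sum fun k _ => hc k θ hθ)
  rw [← Finset.sum_mul] at h1
  rw [e]
  refine (abs_sub _ _).trans ?_
  rw [abs_mul, abs_mul, abs_mul, abs_two]
  have h2 := mul_le_mul_of_nonneg_left (hc n θ hθ) (abs_nonneg (1 + (2 * (n : ℝ) - 1) * N))
  have h3 := mul_le_mul_of_nonneg_left h1 (by positivity : 0 ≤ 2 * |N|)
  calc _ ≤ _ := add_le_add h2 h3
    _ = _ := by ring

@[fun_prop]
theorem continuous_dirichlet (n : ℕ) : Continuous (dirichlet n) := by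
  unfold dirichlet
  fun_prop

@[fun_prop]
theorem continuous_eigenfun (N : ℝ) (n : ℕ) : Continuous (eigenfun N n) := by
  unfold eigenfun
  fun_prop

@[fun_prop]
theorem continuous_symbol (lam : ℝ) : Continuous (symbol lam) := by
  unfold symbol
  fun_prop

theorem statDist_mul_le (hN : 0 < N) (n : ℕ) :
    statDist N n * (1 + (2 * (n : ℝ) + 1) * N) ≤ (4 + N) / (n + 1) := by
  cases n with
  | zero =>
    rw [statDist]
    push_cast
    have : N / (1 + N) * (1 + (2 * 0 + 1) * N) = N := by field_simp; ring
    rw [this]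
    linarith
  | succ n =>
    rw [statDist]
    have e : 1 + (2 * ((n + 1 : ℕ) : ℝ) + 1) * N = 1 + (2 * (n : ℝ) + 3) * N := by
      push_cast; ring
    have h : 2 * N / ((1 + (2 * (n : ℝ) + 1) * N) * (1 + (2 * (n : ℝ) + 3) * N)) *
        (1 + (2 * (n : ℝ) + 3) * N) = 2 * N / (1 + (2 * (n : ℝ) + 1) * N) := by
      field_simp
    rw [e, h, div_le_div_iff₀ (by positivity) (by positivity)]
    push_cast
    have : (0 : ℝ) ≤ n := n.cast_nonneg
    nlinarith [mul_nonneg this hN.le, mul_nonneg (mul_nonneg this hN.le) hN.le, mul_pos hN hN]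

theorem statDist_mul_abs_eigenfun_le (hN : 0 < N) (n : ℕ) (θ : ℝ) :
    statDist N n * |eigenfun N n θ| ≤ 2 * (4 + N) / (n + 1) := by
  have h1 := mul_le_mul_of_nonneg_left (abs_eigenfun_le hN n θ) (statDist_pos hN n).le
  have h2 := statDist_mul_le hN n
  calc _ ≤ 2 * (statDist N n * (1 + (2 * (n : ℝ) + 1) * N)) := by linarith
    _ ≤ 2 * ((4 + N) / (n + 1)) := by linarith
    _ = _ := by ring

theorem statDist_mul_eigenfun_sq_le (hN : 0 < N) (n : ℕ) (θ : ℝ) :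
    statDist N n * eigenfun N n θ ^ 2 ≤ 4 * (4 + N) * (1 + 2 * N) := by
  have hn : (0 : ℝ) ≤ n := n.cast_nonneg
  have h2 := statDist_mul_abs_eigenfun_le hN n θ
  have h1 := abs_eigenfun_le hN n θ
  have h3 : 2 * (1 + (2 * (n : ℝ) + 1) * N) ≤ 2 * ((1 + 2 * N) * (n + 1)) := by
    nlinarith [mul_nonneg hn hN.le]
  calc statDist N n * eigenfun N n θ ^ 2
      = (statDist N n * |eigenfun N n θ|) * |eigenfun N n θ| := by
        rw [← sq_abs]; ring
    _ ≤ (2 * (4 + N) / (n + 1)) * (2 * ((1 + 2 * N) * (n + 1))) :=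
        mul_le_mul h2 (h1.trans h3) (abs_nonneg _) (by positivity)
    _ = _ := by field_simp; ring

/-! ### Absence of a spectral gap -/

/-- For `f` in `ℓ²(ν)` the equation `(P - s) f = δ₀` has no solution when `s` is a value of the
symbol. The weighted Casoratian of `f` and the eigenfunction at `s` does not depend on the site
and is not zero, while it would have to tend to zero because the eigenfunction is `O(ν ^ (-1/2))`. -/
theorem not_exists_resolvent (hN : 0 < N)
    (hlam : 2 * N ^ 2 / ((1 + N) * (1 + 3 * N)) ≤ lam) (θ : ℝ) {f : ℕ → ℝ}
    (hf : f ∈ ell2 (statDist N)) :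
    ¬ ∀ m, act (walk N lam) f m - symbol lam θ * f m = if m = 0 then 1 else 0 := by
  intro h
  have hl := lam_pos hN hlam
  set Q : ℕ → ℝ := fun n => eigenfun N n θ with hQ
  have hW : ∀ n, statDist N n * up N lam n * (Q n * f (n + 1) - Q (n + 1) * f n) =
      statDist N 0 := by
    intro n
    induction n with
    | zero =>
      have h1 := act_eigenfun hN hl θ 0
      have h2 := h 0
      rw [act_walk, down_zero] at h1 h2
      have h3 : Q 0 = 1 := eigenfun_zero θ
      rw [if_pos rfl] at h2
      change up N lam 0 * Q (0 + 1) + stay N lam 0 * Q 0 + 0 * Q (0 - 1) =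
        symbol lam θ * Q 0 at h1
      rw [h3] at h1 ⊢
      linear_combination statDist N 0 * h2 - statDist N 0 * f 0 * h1
    | succ n ih =>
      have h1 : up N lam (n + 1) * Q (n + 1 + 1) + stay N lam (n + 1) * Q (n + 1)
          + down N lam (n + 1) * Q (n + 1 - 1) = symbol lam θ * Q (n + 1) := by
        rw [← act_walk]
        exact act_eigenfun hN hl θ (n + 1)
      have h2 := h (n + 1)
      rw [act_walk, if_neg (Nat.succ_ne_zero n)] at h2
      rw [Nat.add_sub_cancel] at h1 h2
      have d := detailed_balance hN hl n
      linear_combination ih + statDist N (n + 1) * Q (n + 1) * h2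
        - statDist N (n + 1) * f (n + 1) * h1 - (Q n * f (n + 1) - Q (n + 1) * f n) * d
  obtain ⟨K, hK⟩ : ∃ K, K = 4 * (4 + N) * (1 + 2 * N) := ⟨_, rfl⟩
  have hQK : ∀ n, statDist N n * Q n ^ 2 ≤ K := fun n => by
    rw [hK]; exact statDist_mul_eigenfun_sq_le hN n θ
  have hf0 : Tendsto (fun n => statDist N n * f n ^ 2) atTop (nhds 0) :=
    Summable.tendsto_atTop_zero hf
  have hf1 : Tendsto (fun n => statDist N (n + 1) * f (n + 1) ^ 2) atTop (nhds 0) :=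
    (tendsto_add_atTop_iff_nat 1).2 hf0
  have hlim : Tendsto (fun n => 2 * K * (statDist N (n + 1) * f (n + 1) ^ 2
      + statDist N n * f n ^ 2)) atTop (nhds 0) := by
    simpa using (hf1.add hf0).const_mul (2 * K)
  have hbound : ∀ n, statDist N 0 ^ 2 ≤ 2 * K * (statDist N (n + 1) * f (n + 1) ^ 2
      + statDist N n * f n ^ 2) := by
    intro n
    have p0 := statDist_pos hN n
    have p1 := statDist_pos hN (n + 1)
    -- The squared weight is at most `ν n * ν (n + 1)`, by detailed balance.
    have hw : (statDist N n * up N lam n) ^ 2 ≤ statDist N n * statDist N (n + 1) := by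
      have u : statDist N n * up N lam n ≤ statDist N n :=
        mul_le_of_le_one_right p0.le (up_le_one hN hlam n)
      have v : statDist N n * up N lam n ≤ statDist N (n + 1) := by
        rw [detailed_balance hN hl]
        exact mul_le_of_le_one_right p1.le (down_le_one hN hlam (n + 1))
      rw [sq]
      exact mul_le_mul u v (mul_nonneg p0.le (up_pos hN hl n).le) p0.le
    have hsq : (Q n * f (n + 1) - Q (n + 1) * f n) ^ 2 ≤
        2 * ((Q n * f (n + 1)) ^ 2 + (Q (n + 1) * f n) ^ 2) := by
      nlinarith [sq_nonneg (Q n * f (n + 1) + Q (n + 1) * f n)]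
    rw [← hW n, mul_pow]
    calc _ ≤ (statDist N n * statDist N (n + 1)) *
          (2 * ((Q n * f (n + 1)) ^ 2 + (Q (n + 1) * f n) ^ 2)) :=
          mul_le_mul hw hsq (sq_nonneg _) (by positivity)
      _ = 2 * ((statDist N n * Q n ^ 2) * (statDist N (n + 1) * f (n + 1) ^ 2)
          + (statDist N (n + 1) * Q (n + 1) ^ 2) * (statDist N n * f n ^ 2)) := by ring
      _ ≤ 2 * (K * (statDist N (n + 1) * f (n + 1) ^ 2) + K * (statDist N n * f n ^ 2)) := by
          gcongr
          · exact hQK n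
          · exact hQK (n + 1)
      _ = _ := by ring
  have := ge_of_tendsto' hlim hbound
  have := pow_pos (statDist_pos hN 0) 2
  linarith

theorem symbol_mem_specSet (hN : 0 < N)
    (hlam : 2 * N ^ 2 / ((1 + N) * (1 + 3 * N)) ≤ lam) (θ : ℝ) :
    symbol lam θ ∈ specSet (walk N lam) (statDist N) := by
  intro h
  have hg : (fun m : ℕ => if m = 0 then (1 : ℝ) else 0) ∈ ell2 (statDist N) := by
    refine summable_of_ne_finset_zero (s := {0}) fun n hn => ?_
    rw [Finset.mem_singleton] at hn
    simp [hn]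
  obtain ⟨f, ⟨hf, hfe⟩, -⟩ := h _ hg
  exact not_exists_resolvent hN hlam θ hf hfe

theorem not_hasSpectralGap (hN : 0 < N)
    (hlam : 2 * N ^ 2 / ((1 + N) * (1 + 3 * N)) ≤ lam) :
    ¬ HasSpectralGap (walk N lam) (statDist N) := by
  rintro ⟨δ, hδ, h⟩
  have hl := lam_pos hN hlam
  set ε := min (δ / 2) (1 / (1 + lam)) with hε
  have hε0 : 0 < ε := lt_min (by positivity) (by positivity)
  have hε1 : ε < δ := (min_le_left _ _).trans_lt (by linarith)
  have hε2 : ε * (1 + lam) ≤ 1 := by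
    have := min_le_right (δ / 2) (1 / (1 + lam))
    rw [← hε, le_div_iff₀ (by positivity)] at this
    exact this
  have hs : symbol lam (Real.arccos (1 - ε * (1 + lam))) = 1 - ε := by
    have : 0 < ε * (1 + lam) := by positivity
    rw [symbol, Real.cos_arccos (by linarith) (by linarith)]
    field_simp
    ring
  have := symbol_mem_specSet hN hlam (Real.arccos (1 - ε * (1 + lam)))
  rw [hs] at this
  exact h _ this ⟨by linarith, by linarith⟩

/-! ### The spectral representation of the law -/

/-- The integral of `φ ^ t * Q_j * Q_n` over `[0, π]`, with `φ` the symbol and `Q` the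
eigenfunctions; the factor `1 / π` of the arcsine law is left out. -/
noncomputable def moment (N lam : ℝ) (t j n : ℕ) : ℝ :=
  ∫ θ in (0 : ℝ)..Real.pi, symbol lam θ ^ t * eigenfun N j θ * eigenfun N n θ

/-- The density of the law at time `t` with respect to the stationary distribution: the integral
of `φ ^ t * Q_j * Q_n` against the orthogonality measure divided by its point mass `N` at `1`,
which contributes the summand `1`. -/
noncomputable def density (N lam : ℝ) (t j n : ℕ) : ℝ :=
  1 + 1 / (N * Real.pi) * moment N lam t j n

theorem density_comm (N lam : ℝ) (t j n : ℕ) : density N lam t j n = density N lam t n j := by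
  simp only [density, moment, mul_right_comm]

theorem act_density (hN : 0 < N) (hl : 0 < lam) (t j n : ℕ) :
    act (walk N lam) (density N lam t j) n = density N lam (t + 1) j n := by
  have hm : moment N lam (t + 1) j n = up N lam n * moment N lam t j (n + 1)
      + stay N lam n * moment N lam t j n + down N lam n * moment N lam t j (n - 1) := by
    simp only [moment]
    rw [← intervalIntegral.integral_const_mul, ← intervalIntegral.integral_const_mul,
      ← intervalIntegral.integral_const_mul, ← intervalIntegral.integral_add,
      ← intervalIntegral.integral_add]
    · refine intervalIntegral.integral_congr fun θ _ => ?_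
      have h := act_eigenfun hN hl θ n
      rw [act_walk] at h
      linear_combination -(symbol lam θ ^ t * eigenfun N j θ) * h
    all_goals exact Continuous.intervalIntegrable (by fun_prop) _ _
  rw [act_walk]
  simp only [density]
  rw [hm, stay]
  ring

theorem integral_cos_nat_mul (k : ℕ) :
    ∫ θ in (0 : ℝ)..Real.pi, Real.cos (k * θ) = if k = 0 then Real.pi else 0 := by
  split_ifs with h
  · simp [h]
  · have hk : (k : ℝ) ≠ 0 := Nat.cast_ne_zero.2 h
    rw [intervalIntegral.integral_comp_mul_left (fun x => Real.cos x) hk]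
    simp

theorem density_zero_zero (hN : 0 < N) (lam : ℝ) (n : ℕ) :
    density N lam 0 0 n = if n = 0 then 1 / statDist N 0 else 0 := by
  have hπ := Real.pi_pos
  cases n with
  | zero =>
    simp only [density, moment, eigenfun_zero, statDist]
    simp
    field_simp
    ring
  | succ n =>
    have hD : ∫ θ in (0 : ℝ)..Real.pi, dirichlet (n + 1) θ = Real.pi := by
      unfold dirichlet
      rw [intervalIntegral.integral_sub, intervalIntegral.integral_const_mul,
        intervalIntegral.integral_finsetSum]
      · simp only [integral_cos_nat_mul]
        simp
        ring
      all_goals intros; exact Continuous.intervalIntegrable (by fun_prop) _ _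
    have hm : moment N lam 0 0 (n + 1) = -(N * Real.pi) := by
      simp only [moment, pow_zero, one_mul, eigenfun_zero]
      unfold eigenfun
      rw [intervalIntegral.integral_sub, intervalIntegral.integral_const_mul,
        intervalIntegral.integral_const_mul, hD, integral_cos_nat_mul]
      · simp
      all_goals exact Continuous.intervalIntegrable (by fun_prop) _ _
    rw [density, hm, if_neg (Nat.succ_ne_zero n)]
    field_simp
    ring

/-- The relation between neighbouring starting sites: `density` is symmetric, so the one-step
operator may act on either site. -/
theorem density_recurrence (hN : 0 < N) (hl : 0 < lam) (t j n : ℕ) :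
    act (walk N lam) (density N lam t j) n =
      up N lam j * density N lam t (j + 1) n + stay N lam j * density N lam t j n
        + down N lam j * density N lam t (j - 1) n := by
  rw [act_density hN hl, density_comm, ← act_density hN hl, act_walk]
  simp only [density_comm N lam t n]

theorem act_single (hN : 0 < N) (hl : 0 < lam) (j n : ℕ) :
    act (walk N lam) (fun m => if m = j then 1 / statDist N j else 0) n =
      walk N lam j n / statDist N n := by
  have p := (statDist_pos hN j).ne'
  have p' := (statDist_pos hN n).ne'
  have e : act (walk N lam) (fun m => if m = j then 1 / statDist N j else 0) n =
      walk N lam n j * (1 / statDist N j) := by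
    unfold act
    rw [tsum_eq_single j]
    · simp
    · intro m hm; simp [hm]
  rw [e, mul_one_div, div_eq_div_iff p p']
  linarith [statDist_mul_walk hN hl n j]

theorem walk_div_recurrence (N lam : ℝ) (j n : ℕ) :
    walk N lam j n / statDist N n =
      up N lam j * (if n = j + 1 then 1 / statDist N (j + 1) else 0)
        + stay N lam j * (if n = j then 1 / statDist N j else 0)
        + down N lam j * (if n = j - 1 then 1 / statDist N (j - 1) else 0) := by
  have h := hasSum_walk_row N lam (fun k => if n = k then 1 / statDist N k else 0) j
  rw [← h.tsum_eq, tsum_eq_single n]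
  · simp [div_eq_mul_inv]
  · intro m hm; simp [Ne.symm hm]

/-- Orthogonality of the eigenfunctions, by induction on `j`: both sides satisfy the same
three-term recurrence in `j`. -/
theorem density_zero (hN : 0 < N) (hl : 0 < lam) (j : ℕ) :
    ∀ n, density N lam 0 j n = if n = j then 1 / statDist N j else 0 := by
  have step : ∀ j, (∀ n, density N lam 0 j n = if n = j then 1 / statDist N j else 0) →
      (∀ n, down N lam j * density N lam 0 (j - 1) n =
        down N lam j * if n = j - 1 then 1 / statDist N (j - 1) else 0) →
      ∀ n, density N lam 0 (j + 1) n = if n = j + 1 then 1 / statDist N (j + 1) else 0 := by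
    intro j h1 h2 n
    have r := density_recurrence hN hl 0 j n
    rw [funext h1, act_single hN hl, walk_div_recurrence, h2] at r
    apply mul_left_cancel₀ (up_pos hN hl j).ne'
    linarith
  induction j using Nat.strong_induction_on with
  | _ j ih =>
    match j with
    | 0 => exact density_zero_zero hN lam
    | 1 => exact step 0 (ih 0 (by omega)) (by simp)
    | j + 2 =>
      refine step (j + 1) (ih (j + 1) (by omega)) fun n => ?_
      rw [Nat.add_sub_cancel, ih j (by omega) n]

theorem law_eq (hN : 0 < N) (hl : 0 < lam) (j t n : ℕ) :
    law (walk N lam) j t n = statDist N n * density N lam t j n := by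
  induction t generalizing n with
  | zero =>
    rw [density_zero hN hl]
    simp only [law]
    split_ifs with h
    · rw [h, mul_one_div_cancel (statDist_pos hN j).ne']
    · rw [mul_zero]
  | succ t ih =>
    simp only [law, ih]
    rw [(hasSum_col hN hl _ n).tsum_eq, act_density hN hl]

theorem abs_statDist_sub_law (hN : 0 < N) (hl : 0 < lam) (j t n : ℕ) :
    |statDist N n - law (walk N lam) j t n| =
      statDist N n * (1 / (N * Real.pi)) * |moment N lam t j n| := by
  have hπ := Real.pi_pos
  have e : statDist N n - law (walk N lam) j t n =
      -(statDist N n * (1 / (N * Real.pi)) * moment N lam t j n) := by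
    rw [law_eq hN hl, density]; ring
  have hc : 0 ≤ statDist N n * (1 / (N * Real.pi)) :=
    mul_nonneg (statDist_pos hN n).le (by positivity)
  rw [e, abs_neg, abs_mul, abs_of_nonneg hc]

theorem law_eq_zero (N lam : ℝ) (j t n : ℕ) (h : j + t < n) : law (walk N lam) j t n = 0 := by
  induction t generalizing n with
  | zero =>
    simp only [law]
    rw [if_neg (by omega)]
  | succ t ih =>
    rw [law]
    refine (tsum_congr fun m => ?_).trans tsum_zero
    by_cases hm : j + t < m
    · rw [ih m hm, zero_mul]
    · rw [walk, if_neg (by omega), if_neg (by omega), if_neg (by omega), mul_zero]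

theorem summable_abs_statDist_sub_law (hN : 0 < N) (j t : ℕ) :
    Summable fun n => |statDist N n - law (walk N lam) j t n| := by
  refine Summable.abs ((hasSum_statDist hN).summable.sub ?_)
  refine summable_of_ne_finset_zero (s := Finset.range (j + t + 1)) fun n hn => ?_
  rw [Finset.mem_range] at hn
  exact law_eq_zero N lam j t n (by omega)

/-! ### Decay of the moments -/

/-- The rate in the Gaussian bound for the symbol. -/
noncomputable def gaussRate (lam : ℝ) : ℝ := 2 * min 1 lam / (Real.pi ^ 2 * (1 + lam))

theorem gaussRate_pos (hl : 0 < lam) : 0 < gaussRate lam := by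
  have := Real.pi_pos
  have : 0 < min 1 lam := lt_min one_pos hl
  unfold gaussRate
  positivity

/-- The symbol is at most `1 - 2θ² / (π²(1 + lam))`, and it is at least
`-(1 - 2 lam / (1 + lam))`, where `θ² ≤ π²`. -/
theorem abs_symbol_le (hl : 0 < lam) {θ : ℝ} (h0 : 0 ≤ θ) (h1 : θ ≤ Real.pi) :
    |symbol lam θ| ≤ Real.exp (-(gaussRate lam * θ ^ 2)) := by
  have hπ := Real.pi_pos
  have hc := Real.cos_le_one_sub_mul_cos_sq (abs_le.2 ⟨by linarith, h1⟩)
  have hc' := Real.neg_one_le_cos θ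
  have hsq : θ ^ 2 / Real.pi ^ 2 ≤ 1 := by
    rw [div_le_one (by positivity)]
    exact pow_le_pow_left₀ h0 h1 2
  have hsq0 : 0 ≤ θ ^ 2 / Real.pi ^ 2 := by positivity
  obtain ⟨y, hy⟩ : ∃ y, y = θ ^ 2 / Real.pi ^ 2 := ⟨_, rfl⟩
  have hcy : Real.cos θ ≤ 1 - 2 * y := by
    rw [hy]; convert hc using 2; ring
  have hg : gaussRate lam * θ ^ 2 = 2 * min 1 lam * y / (1 + lam) := by
    rw [gaussRate, hy]; field_simp
  rw [← hy] at hsq hsq0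
  have hle : |symbol lam θ| ≤ 1 - gaussRate lam * θ ^ 2 := by
    have m1 : min 1 lam * y ≤ y := mul_le_of_le_one_left hsq0 (min_le_left _ _)
    have m2 : min 1 lam * y ≤ lam :=
      (mul_le_of_le_one_right (le_min one_pos.le hl.le) hsq).trans (min_le_right _ _)
    have e : 1 - 2 * min 1 lam * y / (1 + lam) =
        (1 + lam - 2 * (min 1 lam * y)) / (1 + lam) := by field_simp
    rw [hg, e, symbol, abs_div, abs_of_pos (by linarith : 0 < 1 + lam)]
    gcongr
    rw [abs_le]
    constructor <;> linarith
  linarith [Real.add_one_le_exp (-(gaussRate lam * θ ^ 2))]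

theorem abs_symbol_pow_le (hl : 0 < lam) {θ : ℝ} (h0 : 0 ≤ θ) (h1 : θ ≤ Real.pi) (t : ℕ) :
    |symbol lam θ| ^ t ≤ Real.exp (-(gaussRate lam * t) * θ ^ 2) := by
  calc _ ≤ Real.exp (-(gaussRate lam * θ ^ 2)) ^ t :=
        pow_le_pow_left₀ (abs_nonneg _) (abs_symbol_le hl h0 h1) t
    _ = _ := by rw [← Real.exp_nat_mul]; ring_nf

theorem integral_exp_neg_mul_sq_le {b : ℝ} (hb : 0 < b) :
    ∫ θ in (0 : ℝ)..Real.pi, Real.exp (-b * θ ^ 2) ≤ Real.sqrt (Real.pi / b) := by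
  rw [← integral_gaussian b, intervalIntegral.integral_of_le Real.pi_pos.le]
  exact MeasureTheory.setIntegral_le_integral (integrable_exp_neg_mul_sq hb)
    (Eventually.of_forall fun θ => (Real.exp_pos _).le)

theorem integral_mul_exp_neg_mul_sq_le {b : ℝ} (hb : 0 < b) :
    ∫ θ in (0 : ℝ)..Real.pi, θ * Real.exp (-b * θ ^ 2) ≤ 1 / (2 * b) := by
  have hd : ∀ θ ∈ Set.uIcc (0 : ℝ) Real.pi,
      HasDerivAt (fun θ => -(1 / (2 * b)) * Real.exp (-b * θ ^ 2))
        (θ * Real.exp (-b * θ ^ 2)) θ := by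
    intro θ _
    have h := (((hasDerivAt_pow 2 θ).const_mul (-b)).exp).const_mul (-(1 / (2 * b)))
    refine h.congr_deriv ?_
    push_cast
    field_simp
  rw [intervalIntegral.integral_eq_sub_of_hasDerivAt hd
    (Continuous.intervalIntegrable (by fun_prop) _ _)]
  have : 0 ≤ 1 / (2 * b) * Real.exp (-b * Real.pi ^ 2) := by positivity
  simp only [ne_eq, OfNat.ofNat_ne_zero, not_false_eq_true, zero_pow, mul_zero, Real.exp_zero,
    mul_one]
  linarith

theorem statDist_mul_abs_moment_le (hN : 0 < N) (hl : 0 < lam) (t j n : ℕ) (ht : 0 < t) :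
    statDist N n * |moment N lam t j n| ≤
      4 * (4 + N) * (1 + (2 * (j : ℝ) + 1) * N) * Real.sqrt (Real.pi / gaussRate lam)
        / Real.sqrt t * (1 / (n + 1)) := by
  have hπ := Real.pi_pos
  have ha := gaussRate_pos hl
  have ht' : (0 : ℝ) < t := Nat.cast_pos.2 ht
  have hb : 0 < gaussRate lam * t := by positivity
  have hν := statDist_pos hN n
  obtain ⟨A, hA⟩ : ∃ A, A = 2 * (1 + (2 * (j : ℝ) + 1) * N) * (2 * (4 + N) / (n + 1)) := ⟨_, rfl⟩
  have h1 : statDist N n * |moment N lam t j n| ≤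
      ∫ θ in (0 : ℝ)..Real.pi, A * Real.exp (-(gaussRate lam * t) * θ ^ 2) := by
    rw [← abs_of_pos hν, ← abs_mul, moment, ← intervalIntegral.integral_const_mul,
      ← Real.norm_eq_abs]
    refine intervalIntegral.norm_integral_le_of_norm_le hπ.le
      (Eventually.of_forall fun θ hθ => ?_)
      (Continuous.intervalIntegrable (by fun_prop) _ _)
    have e : ‖statDist N n * (symbol lam θ ^ t * eigenfun N j θ * eigenfun N n θ)‖ =
        |eigenfun N j θ| * (statDist N n * |eigenfun N n θ|) * |symbol lam θ| ^ t := by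
      rw [Real.norm_eq_abs, abs_mul, abs_mul, abs_mul, abs_pow, abs_of_pos hν]
      ring
    rw [e, hA]
    exact mul_le_mul (mul_le_mul (abs_eigenfun_le hN j θ) (statDist_mul_abs_eigenfun_le hN n θ)
      (by positivity) (by positivity)) (abs_symbol_pow_le hl hθ.1.le hθ.2 t)
      (by positivity) (by positivity)
  rw [intervalIntegral.integral_const_mul] at h1
  have hA0 : 0 ≤ A := by rw [hA]; positivity
  have h2 := mul_le_mul_of_nonneg_left (integral_exp_neg_mul_sq_le hb) hA0
  refine (h1.trans h2).trans (le_of_eq ?_)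
  rw [← div_div, Real.sqrt_div (by positivity : 0 ≤ Real.pi / gaussRate lam), hA]
  field_simp
  ring

/-! ### The upper bound -/

/-- Up to the site `j + t` the harmonic sum gives the logarithm; beyond it the law vanishes and
the stationary distribution has mass `O(1 / t)`. -/
theorem exists_tvDist_le (hN : 0 < N) (hl : 0 < lam) (j : ℕ) :
    ∃ C : ℝ, 0 < C ∧ ∀ᶠ t : ℕ in atTop,
      tvDist (statDist N) (law (walk N lam) j t) ≤ C * (Real.log t / Real.sqrt t) := by
  have hπ := Real.pi_pos
  have ha := gaussRate_pos hl
  obtain ⟨K, hK⟩ : ∃ K, K = 1 / (N * Real.pi) * (4 * (4 + N) * (1 + (2 * (j : ℝ) + 1) * N) *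
    Real.sqrt (Real.pi / gaussRate lam)) := ⟨_, rfl⟩
  have hK0 : 0 < K := by rw [hK]; positivity
  refine ⟨1 / 2 * (3 * K + 1 / N), by positivity, ?_⟩
  filter_upwards [eventually_ge_atTop (max 3 (j + 1))] with t ht
  have ht3 : 3 ≤ t := (le_max_left _ _).trans ht
  have htj : j + 1 ≤ t := (le_max_right _ _).trans ht
  have ht0 : (0 : ℝ) < t := by exact_mod_cast (by omega : 0 < t)
  have hlog : 1 ≤ Real.log t := by
    rw [Real.le_log_iff_exp_le ht0]
    have : (3 : ℝ) ≤ t := by exact_mod_cast ht3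
    linarith [Real.exp_one_lt_d9]
  have hs : 1 ≤ Real.sqrt t := Real.one_le_sqrt.2 (by exact_mod_cast (by omega : 1 ≤ t))
  have hs0 : 0 < Real.sqrt t := by linarith
  have hhead : ∑ n ∈ Finset.range (j + t + 1), |statDist N n - law (walk N lam) j t n| ≤
      3 * K * (Real.log t / Real.sqrt t) := by
    have h1 : ∑ n ∈ Finset.range (j + t + 1), |statDist N n - law (walk N lam) j t n| ≤
        ∑ n ∈ Finset.range (j + t + 1), K / Real.sqrt t * (1 / ((n : ℝ) + 1)) := by
      refine Finset.sum_le_sum fun n _ => ?_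
      rw [abs_statDist_sub_law hN hl]
      have := mul_le_mul_of_nonneg_left (statDist_mul_abs_moment_le hN hl t j n (by omega))
        (by positivity : 0 ≤ 1 / (N * Real.pi))
      rw [hK]
      calc _ = 1 / (N * Real.pi) * (statDist N n * |moment N lam t j n|) := by ring
        _ ≤ _ := this
        _ = _ := by ring
    have h2 : ∑ n ∈ Finset.range (j + t + 1), 1 / ((n : ℝ) + 1) ≤ 3 * Real.log t := by
      have h3 := harmonic_le_one_add_log (j + t + 1)
      have h4 : ((harmonic (j + t + 1) : ℚ) : ℝ) =
          ∑ n ∈ Finset.range (j + t + 1), 1 / ((n : ℝ) + 1) := by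
        simp [harmonic]
      have h5 : Real.log ((j + t + 1 : ℕ) : ℝ) ≤ 2 * Real.log t := by
        have h6 : Real.log ((t : ℝ) ^ 2) = 2 * Real.log t := by
          rw [Real.log_pow]; norm_num
        rw [← h6]
        apply Real.log_le_log (by positivity)
        have : j + t + 1 ≤ t ^ 2 := by nlinarith
        exact_mod_cast this
      rw [h4] at h3
      linarith
    rw [← Finset.mul_sum] at h1
    calc _ ≤ _ := h1
      _ ≤ K / Real.sqrt t * (3 * Real.log t) := mul_le_mul_of_nonneg_left h2 (by positivity)
      _ = _ := by ring
  have htail : ∑' n, |statDist N (n + (j + t + 1)) - law (walk N lam) j t (n + (j + t + 1))| ≤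
      1 / N * (Real.log t / Real.sqrt t) := by
    have e : ∀ n, |statDist N (n + (j + t + 1)) - law (walk N lam) j t (n + (j + t + 1))| =
        statDist N (n + (j + t + 1)) := fun n => by
      rw [law_eq_zero N lam j t _ (by omega), sub_zero, abs_of_pos (statDist_pos hN _)]
    simp only [e]
    have h1 := (hasSum_statDist hN).summable.sum_add_tsum_nat_add (j + t + 1)
    rw [sum_range_statDist hN, (hasSum_statDist hN).tsum_eq] at h1
    have h2 : 1 / (1 + (2 * ((j + t : ℕ) : ℝ) + 1) * N) ≤ 1 / (N * t) := by
      apply one_div_le_one_div_of_le (by positivity)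
      push_cast
      have : (0 : ℝ) ≤ j * N := by positivity
      nlinarith [mul_pos ht0 hN]
    have h3 : 1 / (t : ℝ) ≤ Real.log t / Real.sqrt t := by
      rw [div_le_div_iff₀ ht0 hs0]
      have : Real.sqrt t ≤ t := by
        nlinarith [Real.mul_self_sqrt ht0.le]
      nlinarith
    calc _ = 1 / (1 + (2 * ((j + t : ℕ) : ℝ) + 1) * N) := by linarith
      _ ≤ 1 / (N * t) := h2
      _ = 1 / N * (1 / t) := by rw [one_div_mul_one_div]
      _ ≤ _ := mul_le_mul_of_nonneg_left h3 (by positivity)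
  rw [tvDist, ← (summable_abs_statDist_sub_law hN j t).sum_add_tsum_nat_add (j + t + 1)]
  linarith

/-! ### The lower bound -/

theorem one_half_le_symbol_pow (hl : 0 < lam) {t : ℕ} (ht : 0 < t) {θ : ℝ} (h0 : 0 ≤ θ)
    (h1 : θ ≤ 1 / Real.sqrt t) : 1 / 2 ≤ symbol lam θ ^ t := by
  have ht0 : (0 : ℝ) < t := Nat.cast_pos.2 ht
  have ht1 : (1 : ℝ) ≤ t := Nat.one_le_cast.2 ht
  have hθ : θ ^ 2 ≤ 1 / t := by
    have := pow_le_pow_left₀ h0 h1 2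
    rwa [div_pow, one_pow, Real.sq_sqrt ht0.le] at this
  have hs : 1 + -(1 / (2 * (t : ℝ))) ≤ symbol lam θ := by
    have hc := Real.one_sub_sq_div_two_le_cos (x := θ)
    rw [symbol, le_div_iff₀ (by linarith)]
    have e : 1 / (2 * (t : ℝ)) = (1 / t) / 2 := by field_simp
    have : 0 < 1 / (2 * (t : ℝ)) := by positivity
    rw [e] at *
    nlinarith
  have h2 : 1 / (2 * (t : ℝ)) ≤ 1 := by
    rw [div_le_one (by positivity)]; linarith
  have h3 := one_add_mul_le_pow (by linarith : -2 ≤ -(1 / (2 * (t : ℝ)))) t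
  have h4 : 1 + (t : ℝ) * -(1 / (2 * (t : ℝ))) = 1 / 2 := by field_simp; norm_num
  rw [h4] at h3
  exact h3.trans (pow_le_pow_left₀ (by linarith) hs t)

/-- The contribution of `|θ| ≤ 1 / √t` is of order `1 / √t`, while the oscillation of the
eigenfunction and the negative part of the symbol cost only `O(1 / t)`. -/
theorem exists_le_moment_zero (N : ℝ) (hl : 0 < lam) (j : ℕ) :
    ∀ᶠ t : ℕ in atTop, 1 / 4 / Real.sqrt t ≤ moment N lam t j 0 := by
  have hπ := Real.pi_gt_three
  have ha := gaussRate_pos hl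
  obtain ⟨B, hB0, hB⟩ := exists_abs_eigenfun_sub_one_le N j
  obtain ⟨D, hD⟩ : ∃ D, D = 2 * (B + 1) / gaussRate lam := ⟨_, rfl⟩
  filter_upwards [eventually_ge_atTop 1, eventually_ge_atTop ⌈D ^ 2⌉₊] with t ht htD
  have ht0 : (0 : ℝ) < t := Nat.cast_pos.2 ht
  have hs0 : 0 < Real.sqrt t := Real.sqrt_pos.2 ht0
  have hs1 : 1 ≤ Real.sqrt t := Real.one_le_sqrt.2 (Nat.one_le_cast.2 ht)
  have hDs : D ≤ Real.sqrt t :=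
    Real.le_sqrt_of_sq_le ((Nat.le_ceil _).trans (by exact_mod_cast htD))
  set b := gaussRate lam * t with hb
  have hb0 : 0 < b := by positivity
  set F : ℝ → ℝ := fun θ => symbol lam θ ^ t * eigenfun N j θ * eigenfun N 0 θ
    + (B + 1) * (θ * Real.exp (-b * θ ^ 2)) with hF
  have hFc : Continuous F := by fun_prop
  have hlow : ∀ θ, 0 ≤ θ → θ ≤ Real.pi →
      symbol lam θ ^ t + θ * Real.exp (-b * θ ^ 2) ≤ F θ := by
    intro θ h0 h1
    have h2 : |symbol lam θ ^ t * (eigenfun N j θ - 1)| ≤ Real.exp (-b * θ ^ 2) * (B * θ) := by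
      rw [abs_mul, abs_pow]
      exact mul_le_mul (abs_symbol_pow_le hl h0 h1 t) (hB θ h0) (abs_nonneg _)
        (Real.exp_pos _).le
    have h3 := (abs_le.1 h2).1
    simp only [hF, eigenfun_zero]
    linarith
  have hpos : ∀ θ, 0 ≤ θ → θ ≤ Real.pi → 0 ≤ F θ := by
    intro θ h0 h1
    refine le_trans ?_ (hlow θ h0 h1)
    have he := Real.exp_pos (-b * θ ^ 2)
    rcases le_or_gt 0 (symbol lam θ) with h | h
    · have := pow_nonneg h t
      positivity
    · -- A negative symbol forces `θ > π / 2 > 1`.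
      have hθ : 1 ≤ θ := by
        by_contra hlt
        have : 0 ≤ Real.cos θ := Real.cos_nonneg_of_neg_pi_div_two_le_of_le
          (by linarith) (by linarith)
        have : 0 ≤ symbol lam θ := by unfold symbol; positivity
        linarith
      have h2 := abs_symbol_pow_le hl h0 h1 t
      rw [← abs_pow] at h2
      have h3 := (abs_le.1 h2).1
      nlinarith
  have hint : 1 / 2 * (1 / Real.sqrt t) ≤ ∫ θ in (0 : ℝ)..Real.pi, F θ := by
    have hle : 1 / Real.sqrt t ≤ Real.pi := by
      have : 1 / Real.sqrt t ≤ 1 := by rw [div_le_one hs0]; exact hs1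
      linarith
    have hle0 : 0 ≤ 1 / Real.sqrt t := by positivity
    have h1 : ∫ θ in (0 : ℝ)..(1 / Real.sqrt t), F θ ≤ ∫ θ in (0 : ℝ)..Real.pi, F θ := by
      refine intervalIntegral.integral_mono_interval le_rfl hle0 hle ?_
        (hFc.intervalIntegrable _ _)
      filter_upwards [MeasureTheory.ae_restrict_mem measurableSet_Ioc] with θ hθ
      exact hpos θ hθ.1.le hθ.2
    have h2 : ∫ θ in (0 : ℝ)..(1 / Real.sqrt t), (1 / 2 : ℝ) ≤
        ∫ θ in (0 : ℝ)..(1 / Real.sqrt t), F θ := by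
      refine intervalIntegral.integral_mono_on hle0 (by simp) (hFc.intervalIntegrable _ _) ?_
      intro θ hθ
      have h3 := hlow θ hθ.1 (hθ.2.trans hle)
      have h4 := one_half_le_symbol_pow hl ht hθ.1 hθ.2
      have h5 : 0 ≤ θ * Real.exp (-b * θ ^ 2) := mul_nonneg hθ.1 (Real.exp_pos _).le
      linarith
    rw [intervalIntegral.integral_const, smul_eq_mul, sub_zero] at h2
    linarith
  have hsplit : ∫ θ in (0 : ℝ)..Real.pi, F θ = moment N lam t j 0
      + (B + 1) * ∫ θ in (0 : ℝ)..Real.pi, θ * Real.exp (-b * θ ^ 2) := by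
    rw [moment, ← intervalIntegral.integral_const_mul, ← intervalIntegral.integral_add]
    all_goals exact Continuous.intervalIntegrable (by fun_prop) _ _
  have hexp := mul_le_mul_of_nonneg_left (integral_mul_exp_neg_mul_sq_le hb0)
    (by linarith : 0 ≤ B + 1)
  have herr : (B + 1) * (1 / (2 * b)) ≤ 1 / 4 / Real.sqrt t := by
    have e : (B + 1) * (1 / (2 * b)) = D / 4 / t := by
      rw [hD, hb]; field_simp; norm_num
    rw [e, div_le_div_iff₀ ht0 hs0]
    nlinarith [Real.mul_self_sqrt ht0.le]
  have e : 1 / 2 * (1 / Real.sqrt t) = 1 / 4 / Real.sqrt t + 1 / 4 / Real.sqrt t := by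
    field_simp; norm_num
  linarith

theorem exists_le_tvDist (hN : 0 < N) (hl : 0 < lam) (j : ℕ) :
    ∃ c : ℝ, 0 < c ∧ ∀ᶠ t : ℕ in atTop,
      c / Real.sqrt t ≤ tvDist (statDist N) (law (walk N lam) j t) := by
  have hπ := Real.pi_pos
  have hν := statDist_pos hN 0
  refine ⟨1 / 2 * (statDist N 0 * (1 / (N * Real.pi)) * (1 / 4)), by positivity, ?_⟩
  filter_upwards [exists_le_moment_zero N hl j] with t ht
  have h1 := (summable_abs_statDist_sub_law (lam := lam) hN j t).le_tsum 0
    (fun n _ => abs_nonneg _)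
  rw [abs_statDist_sub_law hN hl] at h1
  have h2 := mul_le_mul_of_nonneg_left (ht.trans (le_abs_self _))
    (by positivity : 0 ≤ statDist N 0 * (1 / (N * Real.pi)))
  rw [tvDist]
  calc _ = 1 / 2 * (statDist N 0 * (1 / (N * Real.pi)) * (1 / 4 / Real.sqrt t)) := by ring
    _ ≤ _ := by linarith

end ChebyshevWalk

theorem theorem4p1 (N lam : ℝ) (hN : 0 < N)
    (hlam : 2 * N ^ 2 / ((1 + N) * (1 + 3 * N)) ≤ lam) :
    ChebyshevWalk.IsStochastic (ChebyshevWalk.walk N lam) ∧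
    ∃ ν : ℕ → ℝ,
      ChebyshevWalk.IsStationary (ChebyshevWalk.walk N lam) ν ∧
      (∀ ν' : ℕ → ℝ, ChebyshevWalk.IsStationary (ChebyshevWalk.walk N lam) ν' → ν' = ν) ∧
      (∀ j : ℕ, ∃ c C : ℝ, 0 < c ∧ 0 < C ∧
        ∀ᶠ t : ℕ in atTop,
          c / Real.sqrt t ≤
            ChebyshevWalk.tvDist ν (ChebyshevWalk.law (ChebyshevWalk.walk N lam) j t) ∧
          ChebyshevWalk.tvDist ν (ChebyshevWalk.law (ChebyshevWalk.walk N lam) j t) ≤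
            C * (Real.log t / Real.sqrt t)) ∧
      ¬ ChebyshevWalk.HasSpectralGap (ChebyshevWalk.walk N lam) ν := by
  have hl := ChebyshevWalk.lam_pos hN hlam
  refine ⟨ChebyshevWalk.isStochastic_walk hN hlam, ChebyshevWalk.statDist N,
    ChebyshevWalk.isStationary_statDist hN hl, fun ν' h => h.eq_statDist hN hl, fun j => ?_,
    ChebyshevWalk.not_hasSpectralGap hN hlam⟩
  obtain ⟨c, hc, h1⟩ := ChebyshevWalk.exists_le_tvDist hN hl j
  obtain ⟨C, hC, h2⟩ := ChebyshevWalk.exists_tvDist_le hN hl j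
  exact ⟨c, C, hc, hC, h1.and h2⟩
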